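/- **Notation.** For a real number $q$ and $i\ge 0$ put $(a;q)_i=\prod_{j=0}^{i-1}(1-aq^j)$, $[i]_q=1+q+\dots+q^{i-1}$, $[i]_q!=[1]_q\cdots[i]_q$, $\binom{i}{j}_q=\frac{[i]_q!}{[j]_q!\,[i-j]_q!}$ for $0\le j\le i$ and $\binom{i}{j}_q=0$ otherwise, and $(a)_i=a(a+1)\cdots(a+i-1)$. The series used below are $${}_4\phi_3\!\left[{a_1,a_2,a_3,a_4\atop b_1,b_2,b_3};q,q\right]=\sum_{i\ge0}\frac{(a_1;q)_i(a_2;q)_i(a_3;q)_i(a_4;q)_i}{(q;q)_i(b_1;q)_i(b_2;q)_i(b_3;q)_i}q^i,\qquad {}_4F_3\!\left[{a_1,a_2,a_3,a_4\atop b_1,b_2,b_3};1\right]=\sum_{i\ge0}\frac{(a_1)_i(a_2)_i(a_3)_i(a_4)_i}{i!\,(b_1)_i(b_2)_i(b_3)_i};$$ they all terminate, terms with vanishing numerator being omitted. Let $\mathcal N$ be the set of all $(n,m,k,l)\in\mathbb Z_{\ge0}^4$ with $m\le\lfloor n/2\rfloor$, $k\le n$ and $m+k-n\le l\le\min(m,k)$.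 For $(n,m,k,l)\in\mathcal N$ put $M=m-l$, $N=n-m-k+l$, and for $x\in\{0,\dots,m\}$ and real $q>0$, $q\ne1$, $$p(x;q)=\binom{n-k}{m-l}_q\frac{\binom nx_q}{\binom nm_q}\,q^x\,\frac{[n-2x+1]_q}{[n-x+1]_q}\;{}_4\phi_3\!\left[{q^{-x},q^{x-n-1},q^{-M},q^{-N}\atop q^{-m},q^{m-n},q^{-M-N}};q,q\right],$$ $$F(x;q)=\binom{n-k}{m-l}_q\frac{\binom nx_q}{\binom nm_q}\;{}_4\phi_3\!\left[{q^{-x},q^{x-n},q^{-M},q^{-N}\atop q^{-m},q^{m-n},q^{-M-N}};q,q\right],$$ $$p(x)=\binom{n-k}{m-l}\frac{\binom nx}{\binom nm}\,\frac{n-2x+1}{n-x+1}\;{}_4F_3\!\left[{-x,x-n-1,-M,-N\atop -m,m-n,-M-N};1\right],$$ $$F(x)=\binom{n-k}{m-l}\frac{\binom nx}{\binom nm}\;{}_4F_3\!\left[{-x,x-n,-M,-N\atop -m,m-n,-M-N};1\right].$$ **Theorem.** 1. If $q$ is a prime power, then for every $(n,m,k,l)\in\mathcal N$ the function $x\mapsto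 p(x;q)$ is the probability mass function of a probability distribution on $\{0,\dots,m\}$, and its cumulative distribution function is $\sum_{u=0}^x p(u;q)=F(x;q)$ for $0\le x\le m$. 2. For every $(n,m,k,l)\in\mathcal N$ we have $\lim_{q\to1}p(x;q)=p(x)$ for $0\le x\le m$; the function $x\mapsto p(x)$ is the probability mass function of a probability distribution on $\{0,\dots,m\}$, and its cumulative distribution function is $\sum_{u=0}^x p(u)=F(x)$ for $0\le x\le m$. 3. There is an $\varepsilon>0$ such that for every real $q$ with $0<|q-1|<\varepsilon$ and every $(n,m,k,l)\in\mathcal N$ the function $x\mapsto p(x;q)$ is the probability mass function of a probability distribution on $\{0,\dots,m\}$, and its cumulative distribution function is $\sum_{u=0}^x p(u;q)=F(x;q)$ for $0\le x\le m$. -/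

import Mathlib

open Filter Topology

noncomputable section

/-- The `q`-shifted factorial `(a;q)_n = (1 - a) (1 - a q) ⋯ (1 - a q ^ (n - 1))`. -/
def qShiftedFactorial (a q : ℝ) (n : ℕ) : ℝ :=
  ∏ j ∈ Finset.range n, (1 - a * q ^ j)

/-- The `i`-th term of the basic hypergeometric series `r φ s` with upper parameters `as`
(`r` of them), lower parameters `bs` (`s` of them), base `q` and argument `z`:
`(a₁,…,a_r;q)_i / (q,b₁,…,b_s;q)_i * ((-1)^i q^(i choose 2))^(1+s-r) * z^i`. -/
def basicHypergeometricTerm (as bs : List ℝ) (q z : ℝ) (i : ℕ) : ℝ :=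
  (as.map fun a => qShiftedFactorial a q i).prod /
      (qShiftedFactorial q q i * (bs.map fun b => qShiftedFactorial b q i).prod) *
    ((-1) ^ i * q ^ i.choose 2) ^ (1 + (bs.length : ℤ) - (as.length : ℤ)) * z ^ i

/-- The basic hypergeometric series `r φ s`, summed over all `i ≥ 0`. In a terminating series an
upper parameter is `q ^ (-x)`, so that the numerators vanish for `i > x`; such terms are `0`
(also when a denominator vanishes there), as is the usual convention. -/
def basicHypergeometric (as bs : List ℝ) (q z : ℝ) : ℝ :=
  ∑' i : ℕ, basicHypergeometricTerm as bs q z i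

/-- The `i`-th term of the generalized hypergeometric series `r F s`:
`(a₁,…,a_r)_i / ((1)_i (b₁,…,b_s)_i) * z^i`, with `(a)_i = a (a + 1) ⋯ (a + i - 1)`. -/
def hypergeometricTerm (as bs : List ℝ) (z : ℝ) (i : ℕ) : ℝ :=
  (as.map fun a => (ascPochhammer ℝ i).eval a).prod /
      ((ascPochhammer ℝ i).eval 1 * (bs.map fun b => (ascPochhammer ℝ i).eval b).prod) * z ^ i

/-- The generalized hypergeometric series `r F s`, summed over all `i ≥ 0`, with the same
convention on terminating series. -/
def hypergeometric (as bs : List ℝ) (z : ℝ) : ℝ :=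
  ∑' i : ℕ, hypergeometricTerm as bs z i

/-- The `q`-integer `[n]_q = 1 + q + ⋯ + q ^ (n - 1)`. -/
def qInteger (q : ℝ) (n : ℕ) : ℝ := ∑ j ∈ Finset.range n, q ^ j

/-- The `q`-factorial `[n]_q! = [1]_q [2]_q ⋯ [n]_q`. -/
def qFactorial (q : ℝ) (n : ℕ) : ℝ := ∏ j ∈ Finset.range n, qInteger q (j + 1)

/-- The `q`-binomial coefficient, zero for `m > n`. -/
def qBinomial (q : ℝ) (n m : ℕ) : ℝ :=
  if m ≤ n then qFactorial q n / (qFactorial q m * qFactorial q (n - m)) else 0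

/-- A terminating basic hypergeometric series is a finite sum. -/
theorem basicHypergeometric_eq_sum {as bs : List ℝ} {q z : ℝ} (hq : q ≠ 0) (x : ℕ)
    (hx : q ^ (-(x : ℤ)) ∈ as) :
    basicHypergeometric as bs q z =
      ∑ i ∈ Finset.range (x + 1), basicHypergeometricTerm as bs q z i := by
  unfold basicHypergeometric
  refine tsum_eq_sum (s := Finset.range (x + 1)) fun i hi => ?_
  have hxi : x < i := by rw [Finset.mem_range] at hi; omega
  have h0 : qShiftedFactorial (q ^ (-(x : ℤ))) q i = 0 :=
    Finset.prod_eq_zero (Finset.mem_range.2 hxi) (by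
      rw [zpow_neg, zpow_natCast, inv_mul_cancel₀ (pow_ne_zero x hq), sub_self])
  have h1 : (as.map fun a => qShiftedFactorial a q i).prod = 0 :=
    List.prod_eq_zero (List.mem_map.2 ⟨_, hx, h0⟩)
  simp [basicHypergeometricTerm, h1]

/-- A terminating hypergeometric series is a finite sum. -/
theorem hypergeometric_eq_sum {as bs : List ℝ} {z : ℝ} (x : ℕ) (hx : -(x : ℝ) ∈ as) :
    hypergeometric as bs z = ∑ i ∈ Finset.range (x + 1), hypergeometricTerm as bs z i := by
  unfold hypergeometric
  refine tsum_eq_sum (s := Finset.range (x + 1)) fun i hi => ?_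
  have hxi : x < i := by rw [Finset.mem_range] at hi; omega
  have h0 : (ascPochhammer ℝ i).eval (-(x : ℝ)) = 0 := by
    rw [ascPochhammer_eval_eq_zero_iff]
    exact ⟨x, hxi, by simp⟩
  have h1 : (as.map fun a => (ascPochhammer ℝ i).eval a).prod = 0 :=
    List.prod_eq_zero (List.mem_map.2 ⟨_, hx, h0⟩)
  simp [hypergeometricTerm, h1]

/-- The parameter set `𝒩` of all `(n, m, k, l)` with
`m ≤ ⌊n / 2⌋`, `k ≤ n` and `m + k - n ≤ l ≤ min m k`. -/
def racahParameters : Set (ℕ × ℕ × ℕ × ℕ) :=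
  {t | match t with
    | (n, m, k, l) => m ≤ n / 2 ∧ k ≤ n ∧ (m : ℤ) + k - n ≤ l ∧ l ≤ min m k}

/-- The value at the real number `q` of the rational function `p(x | n,m,k,l;q)`, with
`M = m - l` and `N = n - m - k + l`. For `(n,m,k,l) ∈ 𝒩`, `x ≤ m` and `0 < q ≠ 1` no denominator
vanishes in the prefactor, nor in the terms `i ≤ min (x, M, N)` of the `4 φ 3`; the remaining
terms have numerator zero. -/
def qRacahP (n m k l : ℕ) (q : ℝ) (x : ℕ) : ℝ :=
  let M : ℤ := m - l
  let N : ℤ := n - m - k + l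
  qBinomial q (n - k) (m - l) * (qBinomial q n x / qBinomial q n m) * q ^ x *
    (qInteger q (n - 2 * x + 1) / qInteger q (n - x + 1)) *
    basicHypergeometric
      [q ^ (-(x : ℤ)), q ^ ((x : ℤ) - n - 1), q ^ (-M), q ^ (-N)]
      [q ^ (-(m : ℤ)), q ^ ((m : ℤ) - n), q ^ (-M - N)] q q

/-- The closed form of the cumulative distribution function at the real number `q`. -/
def qRacahCdf (n m k l : ℕ) (q : ℝ) (x : ℕ) : ℝ :=
  let M : ℤ := m - l
  let N : ℤ := n - m - k + l
  qBinomial q (n - k) (m - l) * (qBinomial q n x / qBinomial q n m) *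
    basicHypergeometric
      [q ^ (-(x : ℤ)), q ^ ((x : ℤ) - n), q ^ (-M), q ^ (-N)]
      [q ^ (-(m : ℤ)), q ^ ((m : ℤ) - n), q ^ (-M - N)] q q

/-- The function `p(x | n,m,k,l)` for `q = 1`. -/
def racahP (n m k l : ℕ) (x : ℕ) : ℝ :=
  let M : ℝ := m - l
  let N : ℝ := n - m - k + l
  ((n - k).choose (m - l) : ℝ) * ((n.choose x : ℝ) / (n.choose m : ℝ)) *
    (((n : ℝ) - 2 * x + 1) / ((n : ℝ) - x + 1)) *
    hypergeometric [-(x : ℝ), (x : ℝ) - n - 1, -M, -N] [-(m : ℝ), (m : ℝ) - n, -M - N] 1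

/-- The closed form of the cumulative distribution function for `q = 1`. -/
def racahCdf (n m k l : ℕ) (x : ℕ) : ℝ :=
  let M : ℝ := m - l
  let N : ℝ := n - m - k + l
  ((n - k).choose (m - l) : ℝ) * ((n.choose x : ℝ) / (n.choose m : ℝ)) *
    hypergeometric [-(x : ℝ), (x : ℝ) - n, -M, -N] [-(m : ℝ), (m : ℝ) - n, -M - N] 1

/-- There is a probability distribution on `{0, …, m}` with probability mass function `p`, whose
cumulative distribution function `P[X ≤ x] = ∑_{u ≤ x} p u` is `F`. -/
def IsDistributionOn (m : ℕ) (p F : ℕ → ℝ) : Prop :=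
  ∃ P : PMF (Fin (m + 1)),
    (∀ x : Fin (m + 1), (P x).toReal = p x) ∧
    ∀ x : Fin (m + 1),
      P.toMeasure.real (Set.Iic x) = ∑ u ∈ Finset.range (x + 1), p u ∧
      ∑ u ∈ Finset.range (x + 1), p u = F x

end

/-!
All assertions follow from the case of real `q > 0`, `q ≠ 1`; there the distribution property holds
without any smallness of `|q - 1|`, and the case `q = 1` is obtained by letting `q → 1`.

Fix such a `q`. Three facts have to be shown.

* *Summation.* `F(x) - F(x-1) = p(x)` holds already for the terms with a fixed summation index: this
  is the contiguous relation `qShiftedFactorial_contiguous`. Hence the partial sums of `p` are `F`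
  (`sum_qRacahP`).
* *Total mass.* For `x = m` two upper parameters of the series in `F(m)` cancel two lower ones, and
  the remaining `₂φ₁` is evaluated by the `q`-Chu–Vandermonde sum (`qRacahCdf_self`).
* *Nonnegativity.* The terms of the `₄φ₃` in `p(x)` alternate in sign. The series is balanced,
  however, and a transformation of Whipple–Sears type (`four_phi_three_transformation`) turns it
  into the sum over `j` of
  `(q^-x)_j ((q^-M)_j)² (q^(k+1-x))_j / ((q)_j (q^-m)_j (q^(m-n))_j (q^(-M-N))_j)
    * q^(j(x+M-n)) * (q^-l)_(x-j) (q^(n+1-m-M-x+j))_(x-j) / ((q^(j-m))_(x-j) (q^(n+1-m-x))_(x-j))`.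
  Each of these terms is nonnegative: it vanishes if `x - j > l` or `x > k`, `x - j ≤ l`, and
  otherwise it is a product of quotients of shifted factorials whose factors have equal signs
  (`qRacah_four_phi_three_nonneg`).

Both the transformation and the Chu–Vandermonde sum rest on the `q`-Pfaff–Saalschütz sum
(`sum_saalschutzTerm`), which is proved by a telescoping recurrence.
-/

variable {q : ℝ}

/-! ### Shifted factorials and the `q`-Saalschütz sum -/

theorem qShiftedFactorial_zero (a q : ℝ) : qShiftedFactorial a q 0 = 1 := by
  simp [qShiftedFactorial]

theorem qShiftedFactorial_succ (a q : ℝ) (n : ℕ) :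
    qShiftedFactorial a q (n + 1) = qShiftedFactorial a q n * (1 - a * q ^ n) := by
  simp [qShiftedFactorial, Finset.prod_range_succ]

theorem qShiftedFactorial_add (a q : ℝ) (m n : ℕ) :
    qShiftedFactorial a q (m + n) =
      qShiftedFactorial a q m * qShiftedFactorial (a * q ^ m) q n := by
  simp [qShiftedFactorial, Finset.prod_range_add, pow_add, mul_assoc]

theorem qShiftedFactorial_succ' (a q : ℝ) (n : ℕ) :
    qShiftedFactorial a q (n + 1) = (1 - a) * qShiftedFactorial (a * q) q n := by
  rw [add_comm, qShiftedFactorial_add]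
  simp [qShiftedFactorial]

theorem qShiftedFactorial_ne_zero_of_le {a : ℝ} {m n : ℕ} (hmn : m ≤ n)
    (h : qShiftedFactorial a q n ≠ 0) : qShiftedFactorial a q m ≠ 0 := by
  obtain ⟨r, rfl⟩ := Nat.exists_eq_add_of_le hmn
  rw [qShiftedFactorial_add] at h
  exact left_ne_zero_of_mul h

theorem zpow_ne_one_of_ne_zero (hq0 : 0 < q) (hq1 : q ≠ 1) {a : ℤ} (ha : a ≠ 0) : q ^ a ≠ 1 := by
  intro h
  exact ha (zpow_right_injective₀ hq0 hq1 (by simpa using h))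

theorem qShiftedFactorial_zpow (hq0 : 0 < q) (a : ℤ) (n : ℕ) :
    qShiftedFactorial (q ^ a) q n = ∏ j ∈ Finset.range n, (1 - q ^ (a + j)) := by
  refine Finset.prod_congr rfl fun j _ => ?_
  rw [zpow_add₀ hq0.ne', zpow_natCast]

theorem qShiftedFactorial_zpow_ne_zero (hq0 : 0 < q) (hq1 : q ≠ 1) {a : ℤ} {n : ℕ}
    (h : 0 < a ∨ a + n ≤ 0) : qShiftedFactorial (q ^ a) q n ≠ 0 := by
  rw [qShiftedFactorial_zpow hq0, Finset.prod_ne_zero_iff]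
  intro j hj
  rw [Finset.mem_range] at hj
  exact sub_ne_zero.2 (zpow_ne_one_of_ne_zero hq0 hq1 (by omega)).symm

theorem qShiftedFactorial_zpow_eq_zero (hq0 : 0 < q) {a : ℤ} {n : ℕ}
    (h0 : a ≤ 0) (h : 0 < a + n) : qShiftedFactorial (q ^ a) q n = 0 := by
  rw [qShiftedFactorial_zpow hq0]
  refine Finset.prod_eq_zero (i := (-a).toNat) (Finset.mem_range.2 (by omega)) ?_
  rw [Int.toNat_of_nonneg (by omega)]
  simp

theorem qShiftedFactorial_self_ne_zero (hq0 : 0 < q) (hq1 : q ≠ 1) (n : ℕ) :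
    qShiftedFactorial q q n ≠ 0 := by
  simpa using qShiftedFactorial_zpow_ne_zero hq0 hq1 (a := 1) (n := n) (by simp)

/-- The `j`-th summand of the `q`-Saalschütz sum with index `i`, for `j ≤ i`. It is normalized so
that its denominator does not involve the parameters `B`, `C`, `g`; the lower parameter of the
usual form is `B C g`. -/
noncomputable def saalschutzTerm (q B C g : ℝ) (i j : ℕ) : ℝ :=
  qShiftedFactorial B q j * qShiftedFactorial C q j *
    qShiftedFactorial (B * C * g * q ^ j) q (i - j) * qShiftedFactorial g q (i - j) * g ^ j /
    (qShiftedFactorial q q j * qShiftedFactorial q q (i - j))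

/-- Up to the factors on the left-hand side, consecutive Saalschütz summands in `i` differ by a
telescoping difference in `j`; the right-hand side is its antidifference. -/
theorem sum_saalschutzTerm_telescope (hq0 : 0 < q) (hq1 : q ≠ 1) (B C g : ℝ) (i J : ℕ)
    (hJ : J ≤ i) :
    ∑ j ∈ Finset.range (J + 1), ((1 - q ^ (i + 1)) * saalschutzTerm q B C g (i + 1) j -
        (1 - B * g * q ^ i) * (1 - C * g * q ^ i) * saalschutzTerm q B C g i j) =
      -(q ^ (i - J) * qShiftedFactorial B q (J + 1) * qShiftedFactorial C q (J + 1) *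
        qShiftedFactorial (B * C * g * q ^ J) q (i - J) * qShiftedFactorial g q (i - J) *
        g ^ (J + 1) / (qShiftedFactorial q q J * qShiftedFactorial q q (i - J))) := by
  have hne := qShiftedFactorial_self_ne_zero hq0 hq1
  induction J with
  | zero =>
    have h0 := hne i
    have h1 := hne (i + 1)
    simp only [zero_add, Finset.sum_range_one, saalschutzTerm, qShiftedFactorial_zero, Nat.sub_zero,
      pow_zero, mul_one, one_mul, qShiftedFactorial_succ] at h1 ⊢
    have h2 := right_ne_zero_of_mul h1
    rw [pow_succ' q i]
    generalize q ^ i = x at *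
    field_simp
    ring
  | succ J ih =>
    obtain ⟨r, rfl⟩ := Nat.exists_eq_add_of_le hJ
    rw [Finset.sum_range_succ, ih (by omega)]
    have e1 : J + 1 + r - J = r + 1 := by omega
    have e2 : J + 1 + r - (J + 1) = r := by omega
    have e3 : J + 1 + r + 1 - (J + 1) = r + 1 := by omega
    simp only [saalschutzTerm, e1, e2, e3]
    have h0 := hne J
    have h0' := hne (J + 1)
    have h1 := hne r
    have h1' := hne (r + 1)
    rw [qShiftedFactorial_succ' (B * C * g * q ^ J)]
    rw [show B * C * g * q ^ J * q = B * C * g * q ^ (J + 1) by ring]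
    rw [qShiftedFactorial_succ (B * C * g * q ^ (J + 1)), qShiftedFactorial_succ g q r]
    rw [qShiftedFactorial_succ B q (J + 1), qShiftedFactorial_succ C q (J + 1)]
    rw [qShiftedFactorial_succ] at h0' h1'
    rw [qShiftedFactorial_succ q q J, qShiftedFactorial_succ q q r]
    have h2 := right_ne_zero_of_mul h0'
    have h3 := right_ne_zero_of_mul h1'
    clear ih hne
    simp only [pow_succ, pow_add]
    generalize q ^ J = x at *
    generalize q ^ r = y at *
    have h4 : 1 - y * q ≠ 0 := by rwa [mul_comm]
    field_simp
    ring

/-- The `q`-Saalschütz sum, free of denominators that depend on the parameters. -/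
theorem sum_saalschutzTerm (hq0 : 0 < q) (hq1 : q ≠ 1) (B C g : ℝ) (i : ℕ) :
    ∑ j ∈ Finset.range (i + 1), saalschutzTerm q B C g i j =
      qShiftedFactorial (B * g) q i * qShiftedFactorial (C * g) q i / qShiftedFactorial q q i := by
  have hne := qShiftedFactorial_self_ne_zero hq0 hq1
  induction i with
  | zero => simp [saalschutzTerm, qShiftedFactorial_zero]
  | succ i ih =>
    have h := sum_saalschutzTerm_telescope hq0 hq1 B C g i i le_rfl
    rw [Finset.sum_sub_distrib, ← Finset.mul_sum, ← Finset.mul_sum, ih] at h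
    have h0 := hne i
    have h1 := hne (i + 1)
    rw [Finset.sum_range_succ]
    simp only [saalschutzTerm, Nat.sub_self, qShiftedFactorial_zero, mul_one, pow_zero,
      one_mul] at h ⊢
    rw [qShiftedFactorial_succ] at h1
    have h3 := right_ne_zero_of_mul h1
    simp only [qShiftedFactorial_succ _ _ i] at h ⊢
    have h4 : 1 - q ^ (i + 1) ≠ 0 := by rwa [pow_succ']
    apply mul_left_cancel₀ h4
    rw [mul_add, sub_eq_iff_eq_add.1 h]
    rw [pow_succ' q i]
    clear h h4
    generalize q ^ i = x at *
    have h4 : 1 - x * q ≠ 0 := by rwa [mul_comm]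
    field_simp
    ring

/-! ### Terminating balanced sums and signs of shifted factorials -/

/-- The factors of `(q ^ (1 - i) / g; q)_j` are, up to monomials, the last `j` factors of
`(g; q)_i`. -/
theorem qShiftedFactorial_reverse (hq0 : 0 < q) {g : ℝ} (hg : g ≠ 0) {i j : ℕ} (hj : j ≤ i) :
    qShiftedFactorial (q ^ (1 - (i : ℤ)) / g) q j * (qShiftedFactorial g q (i - j) * g ^ j) =
      (∏ t ∈ Finset.range j, -q ^ (1 - (i : ℤ) + t)) * qShiftedFactorial g q i := by
  induction j with
  | zero => simp [qShiftedFactorial_zero]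
  | succ j ih =>
    obtain ⟨r, rfl⟩ := Nat.exists_eq_add_of_le hj
    have e1 : j + 1 + r - j = r + 1 := by omega
    have e2 : j + 1 + r - (j + 1) = r := by omega
    specialize ih (by omega)
    rw [e1, qShiftedFactorial_succ g] at ih
    rw [e2, Finset.prod_range_succ, qShiftedFactorial_succ, pow_succ]
    have e3 : q ^ (1 - ((j + 1 + r : ℕ) : ℤ) + j) * q ^ r = 1 := by
      rw [← zpow_natCast, ← zpow_add₀ hq0.ne']
      convert zpow_zero q using 2
      push_cast
      ring
    have e4 : (1 - q ^ (1 - ((j + 1 + r : ℕ) : ℤ)) / g * q ^ j) * g =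
        -q ^ (1 - ((j + 1 + r : ℕ) : ℤ) + j) * (1 - g * q ^ r) := by
      have e5 : q ^ (1 - ((j + 1 + r : ℕ) : ℤ)) / g * q ^ j * g =
          q ^ (1 - ((j + 1 + r : ℕ) : ℤ) + j) := by
        rw [zpow_add₀ hq0.ne', zpow_natCast]
        field_simp
      linear_combination -e5 - g * e3
    linear_combination (-q ^ (1 - ((j + 1 + r : ℕ) : ℤ) + j)) * ih +
      (qShiftedFactorial (q ^ (1 - ((j + 1 + r : ℕ) : ℤ)) / g) q j *
        qShiftedFactorial g q r * g ^ j) * e4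

/-- Quotient of two reversals: the ratio of shifted factorials in a terminating series, written
without negative powers of `q`. -/
theorem qShiftedFactorial_neg_div_reverse (hq0 : 0 < q) (hq1 : q ≠ 1) {g : ℝ} (hg : g ≠ 0)
    {i j : ℕ} (hj : j ≤ i) (hgi : qShiftedFactorial g q i ≠ 0) :
    qShiftedFactorial (q ^ (-(i : ℤ))) q j / qShiftedFactorial (q ^ (1 - (i : ℤ)) / g) q j * q ^ j =
      qShiftedFactorial q q i * qShiftedFactorial g q (i - j) * g ^ j /
        (qShiftedFactorial q q (i - j) * qShiftedFactorial g q i) := by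
  have h1 := qShiftedFactorial_reverse hq0 hg hj
  have h2 := qShiftedFactorial_reverse hq0 hq0.ne' hj
  rw [show q ^ (1 - (i : ℤ)) / q = q ^ (-(i : ℤ)) by
    rw [div_eq_mul_inv, ← zpow_sub_one₀ hq0.ne']; congr 1; ring] at h2
  have hP : (∏ t ∈ Finset.range j, -q ^ (1 - (i : ℤ) + t)) ≠ 0 :=
    Finset.prod_ne_zero_iff.2 fun t _ => neg_ne_zero.2 (zpow_ne_zero _ hq0.ne')
  have h3 := qShiftedFactorial_self_ne_zero hq0 hq1 (i - j)
  have h4 : qShiftedFactorial (q ^ (1 - (i : ℤ)) / g) q j ≠ 0 := by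
    refine left_ne_zero_of_mul (h1.trans_ne (mul_ne_zero hP hgi))
  generalize (∏ t ∈ Finset.range j, -q ^ (1 - (i : ℤ) + t)) = P at *
  rw [div_mul_eq_mul_div, div_eq_div_iff h4 (mul_ne_zero h3 hgi)]
  apply mul_left_cancel₀ hP
  linear_combination (P * qShiftedFactorial g q i) * h2 - (P * qShiftedFactorial q q i) * h1

/-- The `q`-Pfaff–Saalschütz sum of a terminating balanced `₃φ₂`. The second lower parameter is
`q ^ (1 - i) / g`, and balance reads `c = A E g`. -/
theorem sum_balanced_three_phi_two (hq0 : 0 < q) (hq1 : q ≠ 1) {A E c g : ℝ} {i : ℕ} (hg : g ≠ 0)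
    (hgi : qShiftedFactorial g q i ≠ 0) (hc : c = A * E * g) (hci : qShiftedFactorial c q i ≠ 0) :
    ∑ j ∈ Finset.range (i + 1), qShiftedFactorial (q ^ (-(i : ℤ))) q j * qShiftedFactorial A q j *
        qShiftedFactorial E q j / (qShiftedFactorial q q j * qShiftedFactorial c q j *
          qShiftedFactorial (q ^ (1 - (i : ℤ)) / g) q j) * q ^ j =
      qShiftedFactorial (A * g) q i * qShiftedFactorial (E * g) q i /
        (qShiftedFactorial c q i * qShiftedFactorial g q i) := by
  have h0 := qShiftedFactorial_self_ne_zero hq0 hq1 i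
  calc _ = ∑ j ∈ Finset.range (i + 1), qShiftedFactorial q q i /
        (qShiftedFactorial c q i * qShiftedFactorial g q i) * saalschutzTerm q A E g i j := by
        refine Finset.sum_congr rfl fun j hj => ?_
        have hj : j ≤ i := by simpa [Nat.lt_succ_iff] using hj
        have h := qShiftedFactorial_neg_div_reverse hq0 hq1 hg hj hgi
        have hcj := qShiftedFactorial_ne_zero_of_le hj hci
        have h1 : qShiftedFactorial c q i =
            qShiftedFactorial c q j * qShiftedFactorial (c * q ^ j) q (i - j) := by
          rw [← qShiftedFactorial_add, Nat.add_sub_cancel' hj]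
        have h2 : qShiftedFactorial (c * q ^ j) q (i - j) ≠ 0 :=
          right_ne_zero_of_mul (h1.symm.trans_ne hci)
        have h3 := qShiftedFactorial_self_ne_zero hq0 hq1 j
        have h4 := qShiftedFactorial_self_ne_zero hq0 hq1 (i - j)
        rw [saalschutzTerm, ← hc, h1]
        calc _ = (qShiftedFactorial (q ^ (-(i : ℤ))) q j /
              qShiftedFactorial (q ^ (1 - (i : ℤ)) / g) q j * q ^ j) *
              (qShiftedFactorial A q j * qShiftedFactorial E q j /
                (qShiftedFactorial q q j * qShiftedFactorial c q j)) := by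
              simp only [div_eq_mul_inv, mul_inv]; ring
          _ = _ := by
              rw [h]
              field_simp
    _ = _ := by
        rw [← Finset.mul_sum, sum_saalschutzTerm hq0 hq1]
        field_simp

/-- The `q`-Chu–Vandermonde sum, with lower parameter `q ^ (1 - i) / g`. -/
theorem sum_two_phi_one (hq0 : 0 < q) (hq1 : q ≠ 1) {A g : ℝ} {i : ℕ} (hg : g ≠ 0)
    (hgi : qShiftedFactorial g q i ≠ 0) :
    ∑ j ∈ Finset.range (i + 1), qShiftedFactorial (q ^ (-(i : ℤ))) q j * qShiftedFactorial A q j /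
        (qShiftedFactorial q q j * qShiftedFactorial (q ^ (1 - (i : ℤ)) / g) q j) * q ^ j =
      qShiftedFactorial (A * g) q i / qShiftedFactorial g q i := by
  have h0 (j : ℕ) : qShiftedFactorial 0 q j = 1 := by simp [qShiftedFactorial]
  simpa [h0] using sum_balanced_three_phi_two hq0 hq1 (A := A) (E := 0) (c := 0) hg hgi
    (by simp) (by simp [h0])

/-- For `a ≥ 0` no factor of `(q ^ a; q)_i` has the sign opposite to that of `1 - q`. -/
theorem exists_qShiftedFactorial_zpow_eq_of_nonneg (hq0 : 0 < q) {a : ℤ} (ha : 0 ≤ a) (i : ℕ) :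
    ∃ c, 0 ≤ c ∧ qShiftedFactorial (q ^ a) q i = (1 - q) ^ i * c := by
  lift a to ℕ using ha
  refine ⟨∏ j ∈ Finset.range i, ∑ t ∈ Finset.range (a + j), q ^ t,
    Finset.prod_nonneg fun j _ => Finset.sum_nonneg fun t _ => by positivity, ?_⟩
  rw [qShiftedFactorial_zpow hq0, ← Finset.card_range i, ← Finset.prod_const, Finset.card_range,
    ← Finset.prod_mul_distrib]
  refine Finset.prod_congr rfl fun j _ => ?_
  rw [mul_neg_geom_sum, ← Nat.cast_add, zpow_natCast]

/-- For `a ≤ 0` either `(q ^ a; q)_i` vanishes or all its factors have the sign of `q - 1`. -/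
theorem exists_qShiftedFactorial_zpow_eq_of_nonpos (hq0 : 0 < q) {a : ℤ} (ha : a ≤ 0) (i : ℕ) :
    ∃ c, 0 ≤ c ∧ qShiftedFactorial (q ^ a) q i = (q - 1) ^ i * c := by
  by_cases hi : 0 < a + i
  · exact ⟨0, le_rfl, by rw [mul_zero, qShiftedFactorial_zpow_eq_zero hq0 ha hi]⟩
  refine ⟨∏ j ∈ Finset.range i, (q ^ (a + j) * ∑ t ∈ Finset.range (-(a + j)).toNat, q ^ t),
    Finset.prod_nonneg fun j _ => by positivity, ?_⟩
  rw [qShiftedFactorial_zpow hq0, ← Finset.card_range i, ← Finset.prod_const, Finset.card_range,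
    ← Finset.prod_mul_distrib]
  refine Finset.prod_congr rfl fun j hj => ?_
  rw [Finset.mem_range] at hj
  rw [mul_left_comm, mul_geom_sum, ← zpow_natCast, Int.toNat_of_nonneg (by omega), mul_sub,
    ← zpow_add₀ hq0.ne', add_neg_cancel, zpow_zero, mul_one]

theorem qShiftedFactorial_div_nonneg_of_nonneg (hq0 : 0 < q) (hq1 : q ≠ 1) {a b : ℤ} (ha : 0 ≤ a)
    (hb : 0 ≤ b) (i : ℕ) :
    0 ≤ qShiftedFactorial (q ^ a) q i / qShiftedFactorial (q ^ b) q i := by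
  obtain ⟨c, hc, h⟩ := exists_qShiftedFactorial_zpow_eq_of_nonneg hq0 ha i
  obtain ⟨d, hd, h'⟩ := exists_qShiftedFactorial_zpow_eq_of_nonneg hq0 hb i
  rw [h, h', mul_div_mul_left _ _ (pow_ne_zero _ (sub_ne_zero.2 hq1.symm))]
  positivity

theorem qShiftedFactorial_div_nonneg_of_nonpos (hq0 : 0 < q) (hq1 : q ≠ 1) {a b : ℤ} (ha : a ≤ 0)
    (hb : b ≤ 0) (i : ℕ) :
    0 ≤ qShiftedFactorial (q ^ a) q i / qShiftedFactorial (q ^ b) q i := by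
  obtain ⟨c, hc, h⟩ := exists_qShiftedFactorial_zpow_eq_of_nonpos hq0 ha i
  obtain ⟨d, hd, h'⟩ := exists_qShiftedFactorial_zpow_eq_of_nonpos hq0 hb i
  rw [h, h', mul_div_mul_left _ _ (pow_ne_zero _ (sub_ne_zero.2 hq1))]
  positivity

/-! ### Transformation and positivity of the `₄φ₃` -/

/-- A transformation of Whipple–Sears type for a terminating balanced `₄φ₃`, obtained by expanding
`(B g)_i (C g)_i / (d)_i` with the `q`-Saalschütz sum, exchanging the summations, and summing
again. -/
theorem four_phi_three_transformation (hq0 : 0 < q) (hq1 : q ≠ 1) {A B C d e f g h : ℝ} {x : ℕ}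
    (hh : h ≠ 0) (hhx : qShiftedFactorial h q x ≠ 0) (hf : f = q ^ (1 - (x : ℤ)) / h)
    (he : e = A * g * h) (hex : qShiftedFactorial e q x ≠ 0) (hd : d = B * C * g)
    (hAd : ∀ i ≤ x, qShiftedFactorial A q i ≠ 0 → qShiftedFactorial d q i ≠ 0) :
    ∑ i ∈ Finset.range (x + 1), qShiftedFactorial (q ^ (-(x : ℤ))) q i * qShiftedFactorial A q i *
        (qShiftedFactorial (B * g) q i * qShiftedFactorial (C * g) q i) /
        (qShiftedFactorial q q i * qShiftedFactorial e q i * qShiftedFactorial f q i *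
          qShiftedFactorial d q i) * q ^ i =
      ∑ j ∈ Finset.range (x + 1), qShiftedFactorial (q ^ (-(x : ℤ))) q j * qShiftedFactorial A q j *
        (qShiftedFactorial B q j * qShiftedFactorial C q j) /
        (qShiftedFactorial q q j * qShiftedFactorial e q j * qShiftedFactorial f q j *
          qShiftedFactorial d q j) * (g * q) ^ j *
        (qShiftedFactorial (A * q ^ j * h) q (x - j) * qShiftedFactorial (g * h) q (x - j) /
          (qShiftedFactorial (e * q ^ j) q (x - j) * qShiftedFactorial h q (x - j))) := by
  have hne := qShiftedFactorial_self_ne_zero hq0 hq1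
  set t : ℕ → ℕ → ℝ := fun j r =>
    qShiftedFactorial (q ^ (-(x : ℤ))) q (j + r) * qShiftedFactorial A q (j + r) /
      (qShiftedFactorial e q (j + r) * qShiftedFactorial f q (j + r)) * q ^ (j + r) *
      (qShiftedFactorial B q j * qShiftedFactorial C q j * qShiftedFactorial g q r * g ^ j /
        (qShiftedFactorial q q j * qShiftedFactorial q q r * qShiftedFactorial d q j)) with ht
  -- The expansion of `(B g)_i (C g)_i / (d)_i`. It is not available where `(d)_i` vanishes, but
  -- there `(A)_i` vanishes as well.
  trans ∑ i ∈ Finset.range (x + 1), ∑ j ∈ Finset.range (i + 1), t j (i - j)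
  · refine Finset.sum_congr rfl fun i hi => ?_
    have hi : i ≤ x := by simpa [Nat.lt_succ_iff] using hi
    by_cases hA : qShiftedFactorial A q i = 0
    · rw [Finset.sum_eq_zero]
      · simp [hA]
      · intro j hj
        have hj : j ≤ i := by simpa [Nat.lt_succ_iff] using hj
        simp only [ht]
        rw [Nat.add_sub_cancel' hj, hA]
        simp
    · have hdi := hAd i hi hA
      trans qShiftedFactorial (q ^ (-(x : ℤ))) q i * qShiftedFactorial A q i /
        (qShiftedFactorial e q i * qShiftedFactorial f q i) * q ^ i /
          qShiftedFactorial d q i * ∑ j ∈ Finset.range (i + 1), saalschutzTerm q B C g i j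
      · rw [sum_saalschutzTerm hq0 hq1]
        simp only [div_eq_mul_inv, mul_inv]
        ring
      · rw [Finset.mul_sum]
        refine Finset.sum_congr rfl fun j hj => ?_
        have hj : j ≤ i := by simpa [Nat.lt_succ_iff] using hj
        have h1 : qShiftedFactorial d q i =
            qShiftedFactorial d q j * qShiftedFactorial (d * q ^ j) q (i - j) := by
          rw [← qShiftedFactorial_add, Nat.add_sub_cancel' hj]
        have h2 : qShiftedFactorial (d * q ^ j) q (i - j) ≠ 0 :=
          right_ne_zero_of_mul (h1.symm.trans_ne hdi)
        simp only [ht, saalschutzTerm]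
        rw [Nat.add_sub_cancel' hj, ← hd, h1]
        generalize qShiftedFactorial (d * q ^ j) q (i - j) = D at *
        calc _ = qShiftedFactorial (q ^ (-(x : ℤ))) q i * qShiftedFactorial A q i /
              (qShiftedFactorial e q i * qShiftedFactorial f q i) * q ^ i *
              (qShiftedFactorial B q j * qShiftedFactorial C q j *
                qShiftedFactorial g q (i - j) * g ^ j /
              (qShiftedFactorial q q j * qShiftedFactorial q q (i - j) *
                qShiftedFactorial d q j)) * (D / D) := by
              simp only [div_eq_mul_inv, mul_inv]; ring
          _ = _ := by rw [div_self h2, mul_one]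
  -- After the exchange of the summations the inner sum is again balanced.
  rw [Finset.sum_range_diag_flip]
  refine Finset.sum_congr rfl fun j hj => ?_
  have hj : j ≤ x := by simpa [Nat.lt_succ_iff] using hj
  rw [show x + 1 - j = (x - j) + 1 by omega]
  have hsum := sum_balanced_three_phi_two hq0 hq1 (A := A * q ^ j) (E := g) (c := e * q ^ j)
    (g := h) (i := x - j) hh (qShiftedFactorial_ne_zero_of_le (Nat.sub_le _ _) hhx)
    (by rw [he]; ring) (by
      rw [← Nat.add_sub_cancel' hj, qShiftedFactorial_add] at hex
      exact right_ne_zero_of_mul hex)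
  have e1 : q ^ (-((x - j : ℕ) : ℤ)) = q ^ (-(x : ℤ)) * q ^ j := by
    rw [Nat.cast_sub hj, ← zpow_natCast, ← zpow_add₀ hq0.ne']
    congr 1; ring
  have e2 : q ^ (1 - ((x - j : ℕ) : ℤ)) / h = f * q ^ j := by
    rw [hf, Nat.cast_sub hj, div_mul_eq_mul_div, ← zpow_natCast, ← zpow_add₀ hq0.ne']
    congr 2; ring
  rw [e1, e2] at hsum
  rw [← hsum, Finset.mul_sum]
  refine Finset.sum_congr rfl fun r _ => ?_
  simp only [ht, qShiftedFactorial_add, div_eq_mul_inv, mul_inv, mul_pow, pow_add]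
  ring

theorem four_phi_three_term (a b c d e f g q : ℝ) (i : ℕ) :
    basicHypergeometricTerm [a, b, c, d] [e, f, g] q q i =
      qShiftedFactorial a q i * qShiftedFactorial b q i * qShiftedFactorial c q i *
        qShiftedFactorial d q i / (qShiftedFactorial q q i * qShiftedFactorial e q i *
          qShiftedFactorial f q i * qShiftedFactorial g q i) * q ^ i := by
  simp [basicHypergeometricTerm, mul_assoc]

/-- After the transformation, with `A = B = q ^ (-M)` and `C = q ^ (k + 1 - x)`, every term of the
series is nonnegative. -/
theorem qRacah_four_phi_three_nonneg (hq0 : 0 < q) (hq1 : q ≠ 1) {n m k l x : ℕ}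
    (hp : (n, m, k, l) ∈ racahParameters) (hx : x ≤ m) :
    0 ≤ basicHypergeometric
      [q ^ (-(x : ℤ)), q ^ ((x : ℤ) - n - 1), q ^ (-((m : ℤ) - l)), q ^ (-((n : ℤ) - m - k + l))]
      [q ^ (-(m : ℤ)), q ^ ((m : ℤ) - n), q ^ (-((m : ℤ) - l) - ((n : ℤ) - m - k + l))] q q := by
  obtain ⟨hmn, hkn, hl, hlm⟩ := hp
  have hlm' : l ≤ m := hlm.trans (min_le_left _ _)
  have hlk : l ≤ k := hlm.trans (min_le_right _ _)
  rw [basicHypergeometric_eq_sum hq0.ne' x (by simp)]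
  have hz (a b : ℤ) : q ^ a * q ^ b = q ^ (a + b) := (zpow_add₀ hq0.ne' a b).symm
  have hzn (a : ℤ) (b : ℕ) : q ^ a * q ^ b = q ^ (a + b) := by rw [← zpow_natCast, hz]
  have key := four_phi_three_transformation hq0 hq1 (x := x) (A := q ^ (-((m : ℤ) - l)))
    (B := q ^ (-((m : ℤ) - l))) (C := q ^ ((k : ℤ) + 1 - x))
    (d := q ^ (-((m : ℤ) - l) - ((n : ℤ) - m - k + l))) (e := q ^ (-(m : ℤ)))
    (f := q ^ ((m : ℤ) - n)) (g := q ^ ((x : ℤ) + m - l - n - 1)) (h := q ^ ((n : ℤ) + 1 - m - x))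
    (zpow_ne_zero _ hq0.ne')
    (qShiftedFactorial_zpow_ne_zero hq0 hq1 (by omega))
    (by rw [← zpow_sub₀ hq0.ne']; congr 1; ring)
    (by rw [hz, hz]; congr 1; ring)
    (qShiftedFactorial_zpow_ne_zero hq0 hq1 (by omega))
    (by rw [hz, hz]; congr 1; ring)
    (by
      intro i _ hA
      apply qShiftedFactorial_zpow_ne_zero hq0 hq1
      contrapose! hA
      exact qShiftedFactorial_zpow_eq_zero hq0 (by omega) (by omega))
  simp only [hz, hzn] at key
  rw [show -((m : ℤ) - l) + (x + m - l - n - 1) = x - n - 1 by ring,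
    show (k : ℤ) + 1 - x + (x + m - l - n - 1) = -((n : ℤ) - m - k + l) by ring,
    show (x : ℤ) + m - l - n - 1 + (n + 1 - m - x) = -(l : ℤ) by ring] at key
  have hterm := Finset.sum_congr (rfl : Finset.range (x + 1) = _) fun i _ =>
    four_phi_three_term (q ^ (-(x : ℤ))) (q ^ ((x : ℤ) - n - 1)) (q ^ (-((m : ℤ) - l)))
      (q ^ (-((n : ℤ) - m - k + l))) (q ^ (-(m : ℤ))) (q ^ ((m : ℤ) - n))
      (q ^ (-((m : ℤ) - l) - ((n : ℤ) - m - k + l))) q i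
  rw [hterm]
  refine le_of_le_of_eq (Finset.sum_nonneg fun j hj => ?_) (key.symm.trans
    (Finset.sum_congr rfl fun i _ => by ring))
  have hj : j ≤ x := by simpa [Nat.lt_succ_iff] using hj
  -- The terms with `x - j > l` vanish. In the others `j ≥ x - l ≥ x - k`, so that for `x > k` the
  -- factor `(q ^ (k + 1 - x))_j` vanishes.
  by_cases hxl : l < x - j
  · rw [qShiftedFactorial_zpow_eq_zero hq0 (a := -(l : ℤ)) (by omega) (by omega)]
    simp
  by_cases hxk : k < x
  · rw [qShiftedFactorial_zpow_eq_zero hq0 (a := (k : ℤ) + 1 - x) (by omega) (by omega)]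
    simp
  -- The factors pair off into quotients of factors of equal sign.
  have r1 := qShiftedFactorial_div_nonneg_of_nonpos hq0 hq1 (a := -(x : ℤ)) (b := -(m : ℤ))
    (by omega) (by omega) j
  have r2 := qShiftedFactorial_div_nonneg_of_nonneg hq0 hq1 (a := (k : ℤ) + 1 - x) (b := 1)
    (by omega) (by omega) j
  have r3 := qShiftedFactorial_div_nonneg_of_nonpos hq0 hq1 (a := -((m : ℤ) - l))
    (b := (m : ℤ) - n) (by omega) (by omega) j
  have r4 := qShiftedFactorial_div_nonneg_of_nonpos hq0 hq1 (a := -((m : ℤ) - l))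
    (b := -((m : ℤ) - l) - ((n : ℤ) - m - k + l)) (by omega) (by omega) j
  have r5 := qShiftedFactorial_div_nonneg_of_nonpos hq0 hq1 (a := -(l : ℤ))
    (b := -(m : ℤ) + j) (by omega) (by omega) (x - j)
  have r6 := qShiftedFactorial_div_nonneg_of_nonneg hq0 hq1
    (a := -((m : ℤ) - l) + j + (n + 1 - m - x)) (b := (n : ℤ) + 1 - m - x)
    (by omega) (by omega) (x - j)
  rw [zpow_one] at r2
  refine le_of_le_of_eq (mul_nonneg (mul_nonneg (mul_nonneg r1 r2) (mul_nonneg r3 r4))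
    (mul_nonneg (mul_nonneg r5 r6)
      (pow_nonneg (mul_nonneg (zpow_nonneg hq0.le ((x : ℤ) + m - l - n - 1)) hq0.le) j))) ?_
  simp only [div_eq_mul_inv, mul_inv]
  ring

/-! ### The distribution for positive `q ≠ 1` -/

theorem qInteger_nonneg (hq0 : 0 ≤ q) (n : ℕ) : 0 ≤ qInteger q n :=
  Finset.sum_nonneg fun _ _ => by positivity

theorem qInteger_succ_pos (hq0 : 0 ≤ q) (n : ℕ) : 0 < qInteger q (n + 1) := by
  rw [qInteger, Finset.sum_range_succ']
  positivity

theorem qFactorial_pos (hq0 : 0 ≤ q) (n : ℕ) : 0 < qFactorial q n :=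
  Finset.prod_pos fun _ _ => qInteger_succ_pos hq0 _

theorem qBinomial_nonneg (hq0 : 0 ≤ q) (n m : ℕ) : 0 ≤ qBinomial q n m := by
  have h := qFactorial_pos hq0
  unfold qBinomial
  split_ifs
  · exact div_nonneg (h _).le (mul_nonneg (h _).le (h _).le)
  · exact le_rfl

theorem qBinomial_pos (hq0 : 0 ≤ q) {n m : ℕ} (hm : m ≤ n) : 0 < qBinomial q n m := by
  have h := qFactorial_pos hq0
  rw [qBinomial, if_pos hm]
  exact div_pos (h _) (mul_pos (h _) (h _))

theorem qInteger_eq (hq1 : q ≠ 1) (n : ℕ) : qInteger q n = (1 - q ^ n) / (1 - q) := by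
  rw [qInteger, geom_sum_eq hq1, ← neg_div_neg_eq, neg_sub, neg_sub]

theorem qFactorial_succ (q : ℝ) (n : ℕ) :
    qFactorial q (n + 1) = qFactorial q n * qInteger q (n + 1) := by
  simp [qFactorial, Finset.prod_range_succ]

theorem qShiftedFactorial_self (q : ℝ) (n : ℕ) :
    qShiftedFactorial q q n = (1 - q) ^ n * qFactorial q n := by
  induction n with
  | zero => simp [qShiftedFactorial, qFactorial]
  | succ n ih =>
    rw [qShiftedFactorial_succ, ih, qFactorial_succ, qInteger, ← pow_succ', ← mul_neg_geom_sum]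
    ring

theorem qBinomial_succ_mul (hq0 : 0 ≤ q) {n x : ℕ} (hx : x + 1 ≤ n) :
    qBinomial q n x = qBinomial q n (x + 1) * (qInteger q (x + 1) / qInteger q (n - x)) := by
  have h := fun n => (qFactorial_pos hq0 n).ne'
  obtain ⟨r, rfl⟩ := Nat.exists_eq_add_of_le hx
  have h1 := (qInteger_succ_pos hq0 x).ne'
  have h2 := (qInteger_succ_pos hq0 r).ne'
  rw [qBinomial, qBinomial, if_pos (by omega), if_pos hx,
    show x + 1 + r - x = r + 1 by omega, show x + 1 + r - (x + 1) = r by omega,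
    qFactorial_succ q r, qFactorial_succ q x]
  have h3 := h x
  have h4 := h r
  field_simp

/-- The contiguous relation behind the summation of the probabilities: it holds for the terms of
the three series with the same index. -/
theorem qShiftedFactorial_contiguous (hq0 : 0 < q) (hq1 : q ≠ 1) {n x : ℕ}
    (hx : 2 * (x + 1) ≤ n) (i : ℕ) :
    qShiftedFactorial (q ^ (-((x + 1 : ℕ) : ℤ))) q i *
        qShiftedFactorial (q ^ (((x + 1 : ℕ) : ℤ) - n)) q i -
      qInteger q (x + 1) / qInteger q (n - x) * (qShiftedFactorial (q ^ (-(x : ℤ))) q i *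
        qShiftedFactorial (q ^ ((x : ℤ) - n)) q i) =
    q ^ (x + 1) * (qInteger q (n - 2 * (x + 1) + 1) / qInteger q (n - x)) *
      (qShiftedFactorial (q ^ (-((x + 1 : ℕ) : ℤ))) q i *
        qShiftedFactorial (q ^ (((x + 1 : ℕ) : ℤ) - n - 1)) q i) := by
  obtain ⟨r, rfl⟩ := Nat.exists_eq_add_of_le hx
  have ea : q ^ (-((x + 1 : ℕ) : ℤ)) = (q ^ (x + 1))⁻¹ := by rw [zpow_neg, zpow_natCast]
  have ea' : q ^ (-(x : ℤ)) = (q ^ (x + 1))⁻¹ * q := by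
    rw [← ea, ← zpow_add_one₀ hq0.ne']; congr 1; push_cast; ring
  have eb : q ^ ((x : ℤ) - (2 * (x + 1) + r : ℕ)) = (q ^ (x + 1 + (r + 1)))⁻¹ := by
    rw [← zpow_natCast, ← zpow_neg]; congr 1; push_cast; ring
  have eb' : q ^ (((x + 1 : ℕ) : ℤ) - (2 * (x + 1) + r : ℕ)) =
      (q ^ (x + 1 + (r + 1)))⁻¹ * q := by
    rw [← eb, ← zpow_add_one₀ hq0.ne']; congr 1; push_cast; ring
  have eb'' : q ^ (((x + 1 : ℕ) : ℤ) - (2 * (x + 1) + r : ℕ) - 1) =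
      (q ^ (x + 1 + (r + 1)))⁻¹ := by
    rw [← eb]; congr 1; push_cast; ring
  rw [ea, ea', eb', eb'', eb, qInteger_eq hq1, qInteger_eq hq1, qInteger_eq hq1,
    show 2 * (x + 1) + r - x = x + 1 + (r + 1) by omega,
    show 2 * (x + 1) + r - 2 * (x + 1) + 1 = r + 1 by omega]
  -- Both shifted products are expressed by the unshifted ones.
  have shift (y : ℕ) : qShiftedFactorial ((q ^ (y + 1))⁻¹ * q) q i =
      qShiftedFactorial (q ^ (y + 1))⁻¹ q i * (q ^ (y + 1) - q ^ i) / (q ^ (y + 1) - 1) := by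
    have h := (qShiftedFactorial_succ' (q ^ (y + 1))⁻¹ q i).symm.trans
      (qShiftedFactorial_succ _ q i)
    have hy : q ^ (y + 1) - 1 ≠ 0 := sub_ne_zero.2 fun h =>
      hq1 ((pow_eq_one_iff_of_nonneg hq0.le y.succ_ne_zero).1 h)
    have hy' : q ^ (y + 1) * (q ^ (y + 1))⁻¹ = 1 := mul_inv_cancel₀ (by positivity)
    rw [eq_div_iff hy]
    linear_combination q ^ (y + 1) * h + (qShiftedFactorial ((q ^ (y + 1))⁻¹ * q) q i -
      qShiftedFactorial (q ^ (y + 1))⁻¹ q i * q ^ i) * hy'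
  rw [shift x, ← add_assoc (x + 1) r 1, shift (x + 1 + r), add_assoc (x + 1) r 1,
    pow_add q (x + 1) (r + 1)]
  have hu : q ^ (x + 1) - 1 ≠ 0 := sub_ne_zero.2 fun h =>
    hq1 ((pow_eq_one_iff_of_nonneg hq0.le x.succ_ne_zero).1 h)
  have hv : q ^ (x + 1) * q ^ (r + 1) - 1 ≠ 0 := by
    rw [← pow_add]
    exact sub_ne_zero.2 fun h => hq1 ((pow_eq_one_iff_of_nonneg hq0.le (by omega)).1 h)
  have h1 := sub_ne_zero.2 hq1.symm
  rw [div_div_div_cancel_right₀ h1, div_div_div_cancel_right₀ h1]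
  generalize qShiftedFactorial (q ^ (x + 1))⁻¹ q i = P
  generalize qShiftedFactorial (q ^ (x + 1) * q ^ (r + 1))⁻¹ q i = R
  generalize q ^ (x + 1) = u at *
  generalize q ^ (r + 1) = w at *
  rw [← neg_sub (u * w) 1, ← neg_sub u 1]
  field_simp
  ring

theorem qRacahCdf_zero (hq0 : 0 < q) (n m k l : ℕ) :
    qRacahCdf n m k l q 0 = qRacahP n m k l q 0 := by
  have h := (qInteger_succ_pos hq0.le n).ne'
  simp only [qRacahCdf, qRacahP]
  rw [basicHypergeometric_eq_sum hq0.ne' 0 (by simp),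
    basicHypergeometric_eq_sum hq0.ne' 0 (by simp)]
  simp [four_phi_three_term, qShiftedFactorial_zero, h]

theorem qRacahCdf_succ (hq0 : 0 < q) (hq1 : q ≠ 1) {n m k l x : ℕ}
    (hx : 2 * (x + 1) ≤ n) :
    qRacahCdf n m k l q (x + 1) = qRacahCdf n m k l q x + qRacahP n m k l q (x + 1) := by
  simp only [qRacahCdf, qRacahP]
  rw [basicHypergeometric_eq_sum hq0.ne' (x + 1) List.mem_cons_self,
    basicHypergeometric_eq_sum hq0.ne' (x + 1) List.mem_cons_self,
    basicHypergeometric_eq_sum hq0.ne' x List.mem_cons_self]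
  -- The series for `x` has one term less; the missing term vanishes.
  have h0 : basicHypergeometricTerm
      [q ^ (-(x : ℤ)), q ^ ((x : ℤ) - n), q ^ (-((m : ℤ) - l)), q ^ (-((n : ℤ) - m - k + l))]
      [q ^ (-(m : ℤ)), q ^ ((m : ℤ) - n), q ^ (-((m : ℤ) - l) - ((n : ℤ) - m - k + l))] q q
        (x + 1) = 0 := by
    rw [four_phi_three_term, qShiftedFactorial_zpow_eq_zero hq0 (by omega) (by omega)]
    simp
  have h1 := Finset.sum_range_succ (fun i => basicHypergeometricTerm
      [q ^ (-(x : ℤ)), q ^ ((x : ℤ) - n), q ^ (-((m : ℤ) - l)), q ^ (-((n : ℤ) - m - k + l))]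
      [q ^ (-(m : ℤ)), q ^ ((m : ℤ) - n), q ^ (-((m : ℤ) - l) - ((n : ℤ) - m - k + l))] q q i)
        (x + 1)
  rw [h0, add_zero] at h1
  rw [← h1, qBinomial_succ_mul hq0.le (show x + 1 ≤ n by omega),
    Finset.mul_sum, Finset.mul_sum, Finset.mul_sum, ← Finset.sum_add_distrib]
  refine Finset.sum_congr rfl fun i _ => ?_
  simp only [four_phi_three_term]
  have h := qShiftedFactorial_contiguous hq0 hq1 hx i
  rw [show n - (x + 1) + 1 = n - x by omega]
  simp only [div_eq_mul_inv, mul_inv] at h ⊢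
  linear_combination (qBinomial q (n - k) (m - l) * (qBinomial q n (x + 1) *
    (qBinomial q n m)⁻¹) * (qShiftedFactorial (q ^ (-((m : ℤ) - l))) q i *
    qShiftedFactorial (q ^ (-((n : ℤ) - m - k + l))) q i * ((qShiftedFactorial q q i)⁻¹ *
    (qShiftedFactorial (q ^ (-(m : ℤ))) q i)⁻¹ * (qShiftedFactorial (q ^ ((m : ℤ) - n)) q i)⁻¹ *
    (qShiftedFactorial (q ^ (-((m : ℤ) - l) - ((n : ℤ) - m - k + l))) q i)⁻¹) * q ^ i)) * h

theorem sum_qRacahP (hq0 : 0 < q) (hq1 : q ≠ 1) {n m k l x : ℕ} (hx : 2 * x ≤ n) :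
    ∑ u ∈ Finset.range (x + 1), qRacahP n m k l q u = qRacahCdf n m k l q x := by
  induction x with
  | zero => simp [qRacahCdf_zero hq0]
  | succ x ih => rw [Finset.sum_range_succ, ih (by omega), qRacahCdf_succ hq0 hq1 hx]

theorem qRacahCdf_self (hq0 : 0 < q) (hq1 : q ≠ 1) {n m k l : ℕ}
    (hp : (n, m, k, l) ∈ racahParameters) : qRacahCdf n m k l q m = 1 := by
  obtain ⟨hmn, hkn, hl, hlm⟩ := hp
  obtain ⟨M, rfl⟩ := Nat.exists_eq_add_of_le (hlm.trans (min_le_left _ _))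
  obtain ⟨N, hN⟩ := Nat.exists_eq_add_of_le (show M + k ≤ n by omega)
  have hN' : n - k = M + N := by omega
  simp only [qRacahCdf]
  rw [basicHypergeometric_eq_sum hq0.ne' (l + M) (by simp), hN', Nat.add_sub_cancel_left,
    div_self (qBinomial_pos hq0.le (by omega)).ne', mul_one]
  rw [show ((l + M : ℕ) : ℤ) - l = M by push_cast; ring,
    show (n : ℤ) - (l + M : ℕ) - k + l = N by push_cast; omega]
  have hgM : qShiftedFactorial (q ^ ((N : ℤ) + 1)) q M ≠ 0 :=
    qShiftedFactorial_zpow_ne_zero hq0 hq1 (by omega)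
  have hsum := sum_two_phi_one hq0 hq1 (A := q ^ (-(N : ℤ))) (g := q ^ ((N : ℤ) + 1)) (i := M)
    (zpow_ne_zero _ hq0.ne') hgM
  rw [← zpow_sub₀ hq0.ne', ← zpow_add₀ hq0.ne', neg_add_cancel_left, zpow_one] at hsum
  rw [← Finset.sum_subset (Finset.range_subset_range.2 (show M + 1 ≤ l + M + 1 by omega)),
    Finset.sum_congr rfl, hsum, qBinomial, if_pos (by omega), Nat.add_sub_cancel_left]
  -- The value `(q)_M / (q ^ (N + 1))_M` of the sum is the inverse of the binomial coefficient.
  · have h1 := qShiftedFactorial_add q q N M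
    rw [qShiftedFactorial_self, qShiftedFactorial_self, ← pow_succ'] at h1
    rw [qShiftedFactorial_self]
    have h2 := sub_ne_zero.2 hq1.symm
    have h3 := (qFactorial_pos hq0.le N).ne'
    have h4 := (qFactorial_pos hq0.le M).ne'
    have h5 : q ^ ((N : ℤ) + 1) = q ^ (N + 1) := by rw [← zpow_natCast]; simp
    rw [h5] at hgM ⊢
    rw [pow_add, mul_assoc, mul_assoc] at h1
    have h6 := mul_left_cancel₀ (pow_ne_zero N h2) h1
    rw [div_mul_div_comm, div_eq_one_iff_eq (by positivity), add_comm M N]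
    linear_combination qFactorial q M * h6
  · intro i hi
    rw [Finset.mem_range] at hi
    have h1 : qShiftedFactorial (q ^ (-((l + M : ℕ) : ℤ))) q i ≠ 0 :=
      qShiftedFactorial_zpow_ne_zero hq0 hq1 (by omega)
    have h2 : qShiftedFactorial (q ^ (((l + M : ℕ) : ℤ) - n)) q i ≠ 0 :=
      qShiftedFactorial_zpow_ne_zero hq0 hq1 (by omega)
    rw [four_phi_three_term, show (1 : ℤ) - M - (N + 1) = -M - N by ring]
    field_simp
  · intro i hi hi'
    rw [Finset.mem_range] at hi'
    rw [four_phi_three_term,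
      qShiftedFactorial_zpow_eq_zero hq0 (a := -(M : ℤ)) (by omega) (by omega)]
    simp

theorem qRacahP_nonneg (hq0 : 0 < q) (hq1 : q ≠ 1) {n m k l x : ℕ}
    (hp : (n, m, k, l) ∈ racahParameters) (hx : x ≤ m) : 0 ≤ qRacahP n m k l q x := by
  have h := qRacah_four_phi_three_nonneg hq0 hq1 hp hx
  have h1 := qBinomial_nonneg hq0.le
  have h2 := qInteger_nonneg hq0.le
  exact mul_nonneg (mul_nonneg (mul_nonneg (mul_nonneg (h1 _ _) (div_nonneg (h1 _ _) (h1 _ _)))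
    (by positivity)) (div_nonneg (h2 _) (h2 _))) h

theorem isDistributionOn_of_nonneg {m : ℕ} {p F : ℕ → ℝ} (hp : ∀ x ≤ m, 0 ≤ p x)
    (hF : ∀ x ≤ m, ∑ u ∈ Finset.range (x + 1), p u = F x) (h1 : F m = 1) :
    IsDistributionOn m p F := by
  have hp' (x : Fin (m + 1)) : 0 ≤ p x := hp x (Nat.lt_succ_iff.1 x.2)
  refine ⟨PMF.ofFintype (fun x => ENNReal.ofReal (p x)) ?_, fun x => ?_, fun x => ⟨?_, ?_⟩⟩
  · rw [← ENNReal.ofReal_sum_of_nonneg fun x _ => hp' x, Fin.sum_univ_eq_sum_range p (m + 1),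
      hF m le_rfl, h1, ENNReal.ofReal_one]
  · rw [PMF.ofFintype_apply, ENNReal.toReal_ofReal (hp' x)]
  · have hx : (x : ℕ) + 1 ≤ m + 1 := x.2
    rw [MeasureTheory.measureReal_def, PMF.toMeasure_apply_fintype,
      ENNReal.toReal_sum fun y _ => by
        by_cases hy : y ∈ Set.Iic x <;> simp [hy]]
    trans ∑ y : Fin (m + 1), if (y : ℕ) < x + 1 then p y else 0
    · refine Finset.sum_congr rfl fun y _ => ?_
      by_cases hy : y ≤ x
      · rw [Set.indicator_of_mem (Set.mem_Iic.2 hy), PMF.ofFintype_apply,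
          ENNReal.toReal_ofReal (hp' y), if_pos (Nat.lt_succ_iff.2 hy)]
      · rw [Set.indicator_of_notMem (by simpa using hy), if_neg (by rw [Nat.lt_succ_iff]; exact hy),
          ENNReal.toReal_zero]
    · rw [Fin.sum_univ_eq_sum_range (fun y => if y < (x : ℕ) + 1 then p y else 0) (m + 1),
        ← Finset.sum_filter]
      refine Finset.sum_congr ?_ fun _ _ => rfl
      ext y
      simp only [Finset.mem_filter, Finset.mem_range]
      omega
  · exact hF x (Nat.lt_succ_iff.1 x.2)

theorem isDistributionOn_qRacahP (hq0 : 0 < q) (hq1 : q ≠ 1) {n m k l : ℕ}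
    (hp : (n, m, k, l) ∈ racahParameters) :
    IsDistributionOn m (qRacahP n m k l q) (qRacahCdf n m k l q) :=
  isDistributionOn_of_nonneg (fun _ => qRacahP_nonneg hq0 hq1 hp)
    (fun _ hx => sum_qRacahP hq0 hq1 (by have := hp.1; omega)) (qRacahCdf_self hq0 hq1 hp)

/-! ### The limit `q → 1` -/

theorem continuous_qFactorial (n : ℕ) : Continuous fun q => qFactorial q n := by
  unfold qFactorial qInteger
  fun_prop

theorem qFactorial_one (n : ℕ) : qFactorial 1 n = n.factorial := by
  simp [qFactorial, qInteger, ← Finset.prod_range_add_one_eq_factorial]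

theorem tendsto_qInteger (n : ℕ) : Tendsto (fun q => qInteger q n) (𝓝[≠] 1) (𝓝 n) := by
  have h : Continuous fun q => qInteger q n := by unfold qInteger; fun_prop
  simpa [qInteger] using (h.tendsto 1).mono_left nhdsWithin_le_nhds

theorem tendsto_qBinomial {n m : ℕ} (hm : m ≤ n) :
    Tendsto (fun q => qBinomial q n m) (𝓝[≠] 1) (𝓝 (n.choose m : ℝ)) := by
  have h (n : ℕ) : Tendsto (fun q => qFactorial q n) (𝓝[≠] 1) (𝓝 (n.factorial : ℝ)) := by
    simpa [qFactorial_one] using ((continuous_qFactorial n).tendsto 1).mono_left nhdsWithin_le_nhds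
  simp only [qBinomial, if_pos hm]
  rw [Nat.cast_choose ℝ hm]
  exact (h n).div ((h m).mul (h (n - m))) (by positivity)

/-- After division by `(1 - q) ^ i` the `q`-shifted factorial `(q ^ a; q)_i` tends to `(a)_i`:
each factor is a difference quotient of a power at `1`. -/
theorem tendsto_qShiftedFactorial_div (a : ℤ) (i : ℕ) :
    Tendsto (fun q : ℝ => qShiftedFactorial (q ^ a) q i / (1 - q) ^ i) (𝓝[≠] 1)
      (𝓝 ((ascPochhammer ℝ i).eval (a : ℝ))) := by
  induction i with
  | zero => simp [qShiftedFactorial_zero]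
  | succ i ih =>
    rw [ascPochhammer_succ_eval]
    have h1 : HasDerivAt (fun q : ℝ => q ^ (a + i)) ((a : ℝ) + i) 1 := by
      simpa using hasDerivAt_zpow (a + i) (1 : ℝ) (Or.inl one_ne_zero)
    refine (ih.mul (hasDerivAt_iff_tendsto_slope.1 h1)).congr' ?_
    have h2 : ∀ᶠ q : ℝ in 𝓝[≠] 1, 0 < q := nhdsWithin_le_nhds (lt_mem_nhds one_pos)
    filter_upwards [h2, self_mem_nhdsWithin] with q hq0 hq1
    have h3 := sub_ne_zero.2 (Ne.symm hq1)
    have h4 := sub_ne_zero.2 hq1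
    rw [slope_def_field, qShiftedFactorial_succ, one_zpow, ← zpow_natCast q i,
      ← zpow_add₀ hq0.ne', ← neg_div_neg_eq (q ^ (a + i) - 1), neg_sub, neg_sub,
      div_mul_div_comm, pow_succ]

/-- Where the lower parameters may produce vanishing denominators, the hypothesis asks that the
upper parameter `q ^ c` makes the term vanish on both sides of the limit. -/
theorem tendsto_four_phi_three_term {a b c d e f g : ℤ} {i : ℕ}
    (h : (c ≤ 0 ∧ 0 < c + i) ∨
      (e + i ≤ 0 ∧ f + i ≤ 0 ∧ g + i ≤ 0)) :
    Tendsto (fun q : ℝ => basicHypergeometricTerm [q ^ a, q ^ b, q ^ c, q ^ d]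
        [q ^ e, q ^ f, q ^ g] q q i) (𝓝[≠] 1)
      (𝓝 (hypergeometricTerm [(a : ℝ), b, c, d] [(e : ℝ), f, g] 1 i)) := by
  have h2 : ∀ᶠ q : ℝ in 𝓝[≠] 1, 0 < q := nhdsWithin_le_nhds (lt_mem_nhds one_pos)
  rcases h with ⟨hc, hci⟩ | ⟨he, hf, hg⟩
  · have h0 : (ascPochhammer ℝ i).eval (c : ℝ) = 0 := by
      rw [ascPochhammer_eval_eq_zero_iff]
      refine ⟨(-c).toNat, by omega, ?_⟩
      rw [← Int.cast_natCast, Int.toNat_of_nonneg (by omega)]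
      simp
    have h1 : hypergeometricTerm [(a : ℝ), b, c, d] [(e : ℝ), f, g] 1 i = 0 := by
      simp [hypergeometricTerm, h0]
    rw [h1]
    refine tendsto_const_nhds.congr' ?_
    filter_upwards [h2] with q hq0
    rw [four_phi_three_term, qShiftedFactorial_zpow_eq_zero hq0 hc hci]
    simp
  · have hne {z : ℤ} (hz : z + i ≤ 0) : (ascPochhammer ℝ i).eval (z : ℝ) ≠ 0 := by
      rw [Ne, ascPochhammer_eval_eq_zero_iff]
      rintro ⟨k, hk, hk'⟩
      have : (k : ℤ) = -z := by exact_mod_cast hk'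
      omega
    have hne1 : (ascPochhammer ℝ i).eval ((1 : ℤ) : ℝ) ≠ 0 := by
      rw [Int.cast_one, ascPochhammer_eval_one]
      positivity
    have t := tendsto_qShiftedFactorial_div (i := i)
    have tq : Tendsto (fun q : ℝ => q ^ i) (𝓝[≠] 1) (𝓝 (1 ^ i)) :=
      ((continuous_pow i).tendsto 1).mono_left nhdsWithin_le_nhds
    have H := (((((t a).mul (t b)).mul (t c)).mul (t d)).div
      ((((t 1).mul (t e)).mul (t f)).mul (t g))
      (mul_ne_zero (mul_ne_zero (mul_ne_zero hne1 (hne he)) (hne hf)) (hne hg))).mul tq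
    have e1 : hypergeometricTerm [(a : ℝ), b, c, d] [(e : ℝ), f, g] 1 i =
        (ascPochhammer ℝ i).eval (a : ℝ) * (ascPochhammer ℝ i).eval (b : ℝ) *
          (ascPochhammer ℝ i).eval (c : ℝ) * (ascPochhammer ℝ i).eval (d : ℝ) /
        ((ascPochhammer ℝ i).eval ((1 : ℤ) : ℝ) * (ascPochhammer ℝ i).eval (e : ℝ) *
          (ascPochhammer ℝ i).eval (f : ℝ) * (ascPochhammer ℝ i).eval (g : ℝ)) * 1 ^ i := by
      simp [hypergeometricTerm, mul_assoc]
    rw [e1]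
    refine H.congr' ?_
    filter_upwards [self_mem_nhdsWithin] with q hq1
    have h3 : (1 - q) ^ i ≠ 0 := pow_ne_zero _ (sub_ne_zero.2 (Ne.symm hq1))
    simp only [Pi.div_apply, div_mul_div_comm]
    rw [four_phi_three_term, zpow_one, div_div_div_cancel_right₀ (by positivity)]

theorem tendsto_four_phi_three {n m k l x : ℕ} (hp : (n, m, k, l) ∈ racahParameters)
    (hx : x ≤ m) (b : ℤ) :
    Tendsto (fun q : ℝ => basicHypergeometric
      [q ^ (-(x : ℤ)), q ^ b, q ^ (-((m : ℤ) - l)), q ^ (-((n : ℤ) - m - k + l))]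
      [q ^ (-(m : ℤ)), q ^ ((m : ℤ) - n), q ^ (-((m : ℤ) - l) - ((n : ℤ) - m - k + l))] q q)
      (𝓝[≠] 1)
      (𝓝 (hypergeometric [-(x : ℝ), b, -((m : ℝ) - l), -((n : ℝ) - m - k + l)]
        [-(m : ℝ), (m : ℝ) - n, -((m : ℝ) - l) - ((n : ℝ) - m - k + l)] 1)) := by
  obtain ⟨hmn, hkn, hl, hlm⟩ := hp
  have hlm' : l ≤ m := hlm.trans (min_le_left _ _)
  rw [hypergeometric_eq_sum x List.mem_cons_self]
  have H := tendsto_finsetSum (Finset.range (x + 1)) fun i hi =>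
    tendsto_four_phi_three_term (a := -(x : ℤ)) (b := b) (c := -((m : ℤ) - l))
      (d := -((n : ℤ) - m - k + l)) (e := -(m : ℤ)) (f := (m : ℤ) - n)
      (g := -((m : ℤ) - l) - ((n : ℤ) - m - k + l)) (i := i) (by
        rw [Finset.mem_range] at hi
        omega)
  push_cast at H
  refine H.congr' ?_
  have h2 : ∀ᶠ q : ℝ in 𝓝[≠] 1, 0 < q := nhdsWithin_le_nhds (lt_mem_nhds one_pos)
  filter_upwards [h2] with q hq0
  rw [basicHypergeometric_eq_sum hq0.ne' x List.mem_cons_self]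

theorem tendsto_qRacahP {n m k l x : ℕ} (hp : (n, m, k, l) ∈ racahParameters) (hx : x ≤ m) :
    Tendsto (fun q : ℝ => qRacahP n m k l q x) (𝓝[≠] 1) (𝓝 (racahP n m k l x)) := by
  have h4 := tendsto_four_phi_three hp hx ((x : ℤ) - n - 1)
  obtain ⟨hmn, hkn, hl, hlm⟩ := hp
  have hlm' : l ≤ m := hlm.trans (min_le_left _ _)
  have hq : Tendsto (fun q : ℝ => q ^ x) (𝓝[≠] 1) (𝓝 1) := by
    simpa using ((continuous_pow x).tendsto (1 : ℝ)).mono_left nhdsWithin_le_nhds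
  have H := ((((tendsto_qBinomial (n := n - k) (m := m - l) (by omega)).mul
    ((tendsto_qBinomial (n := n) (m := x) (by omega)).div
      (tendsto_qBinomial (n := n) (m := m) (by omega))
      (Nat.cast_ne_zero.2 (Nat.choose_pos (by omega)).ne'))).mul hq).mul
    ((tendsto_qInteger (n - 2 * x + 1)).div (tendsto_qInteger (n - x + 1))
      (Nat.cast_ne_zero.2 (Nat.succ_ne_zero _)))).mul h4
  convert (show Tendsto (fun q => qRacahP n m k l q x) (𝓝[≠] 1) (𝓝 _) from H) using 2
  simp only [racahP]
  push_cast [Nat.cast_sub (show 2 * x ≤ n by omega), Nat.cast_sub (show x ≤ n by omega)]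
  rw [mul_one]

theorem tendsto_qRacahCdf {n m k l x : ℕ} (hp : (n, m, k, l) ∈ racahParameters) (hx : x ≤ m) :
    Tendsto (fun q : ℝ => qRacahCdf n m k l q x) (𝓝[≠] 1) (𝓝 (racahCdf n m k l x)) := by
  have h4 := tendsto_four_phi_three hp hx ((x : ℤ) - n)
  obtain ⟨hmn, hkn, hl, hlm⟩ := hp
  have hlm' : l ≤ m := hlm.trans (min_le_left _ _)
  have H := ((tendsto_qBinomial (n := n - k) (m := m - l) (by omega)).mul
    ((tendsto_qBinomial (n := n) (m := x) (by omega)).div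
      (tendsto_qBinomial (n := n) (m := m) (by omega))
      (Nat.cast_ne_zero.2 (Nat.choose_pos (by omega)).ne'))).mul h4
  convert (show Tendsto (fun q => qRacahCdf n m k l q x) (𝓝[≠] 1) (𝓝 _) from H) using 2
  simp only [racahCdf]
  push_cast
  rfl

/-- Nonnegativity, the summation formula and the total mass pass to the pointwise limit
`q → 1`. -/
theorem isDistributionOn_racahP {n m k l : ℕ} (hp : (n, m, k, l) ∈ racahParameters) :
    IsDistributionOn m (racahP n m k l) (racahCdf n m k l) := by
  have hm := hp.1
  have h0 : ∀ᶠ q : ℝ in 𝓝[≠] 1, 0 < q := nhdsWithin_le_nhds (lt_mem_nhds one_pos)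
  refine isDistributionOn_of_nonneg (fun x hx => ?_) (fun x hx => ?_) ?_
  · refine ge_of_tendsto (tendsto_qRacahP hp hx) ?_
    filter_upwards [h0, self_mem_nhdsWithin] with q hq0 hq1
    exact qRacahP_nonneg hq0 hq1 hp hx
  · refine tendsto_nhds_unique (tendsto_finsetSum _ fun u hu => tendsto_qRacahP hp ?_)
      ((tendsto_qRacahCdf hp hx).congr' ?_)
    · rw [Finset.mem_range] at hu
      omega
    · filter_upwards [h0, self_mem_nhdsWithin] with q hq0 hq1
      exact (sum_qRacahP hq0 hq1 (by omega)).symm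
  · refine tendsto_nhds_unique (tendsto_qRacahCdf hp le_rfl) (tendsto_const_nhds.congr' ?_)
    filter_upwards [h0, self_mem_nhdsWithin] with q hq0 hq1
    exact (qRacahCdf_self hq0 hq1 hp).symm

theorem mainTheorem1 :
    (∀ q : ℕ, IsPrimePow q → ∀ n m k l : ℕ, (n, m, k, l) ∈ racahParameters →
      IsDistributionOn m (qRacahP n m k l q) (qRacahCdf n m k l q)) ∧
    (∀ n m k l : ℕ, (n, m, k, l) ∈ racahParameters →
      (∀ x ≤ m, Tendsto (fun q : ℝ => qRacahP n m k l q x) (𝓝[≠] 1) (𝓝 (racahP n m k l x))) ∧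
      IsDistributionOn m (racahP n m k l) (racahCdf n m k l)) ∧
    (∃ ε : ℝ, 0 < ε ∧ ∀ q : ℝ, q ≠ 1 → |q - 1| < ε →
      ∀ n m k l : ℕ, (n, m, k, l) ∈ racahParameters →
        IsDistributionOn m (qRacahP n m k l q) (qRacahCdf n m k l q)) := by
  refine ⟨fun q hq n m k l hp => ?_, fun n m k l hp =>
    ⟨fun x hx => tendsto_qRacahP hp hx, isDistributionOn_racahP hp⟩, 1, one_pos,
    fun q hq1 hq n m k l hp => ?_⟩
  · exact isDistributionOn_qRacahP (by exact_mod_cast hq.pos) (by exact_mod_cast hq.one_lt.ne') hp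
  · -- The result holds for all positive `q ≠ 1`, so that `ε = 1` will do.
    exact isDistributionOn_qRacahP (by linarith [(abs_lt.1 hq).1]) hq1 hp
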